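/- Let $\mathcal H$ be a separable infinite-dimensional complex Hilbert space and let $a\in\mathcal B(\mathcal H)$ be a normal operator. Let $p_a$ be the orthogonal projection onto the closure $\overline{\operatorname{Ran} a}$ of the range of $a$, and let $$\mathcal O_a=\{vav^*\mid v\in\mathcal B(\mathcal H)\text{ a partial isometry with } v^*v=p_a\}$$ be the groupoid orbit of $a$. Then the following conditions are equivalent: (i) $\mathcal O_a$ is closed in $\mathcal B(\mathcal H)$ in the operator norm topology. (ii) The compact set $\operatorname{spec}(a)\subseteq\mathbb C$ accumulates at most at $0$, that is, every accumulation point of $\operatorname{spec}(a)$ is equal to $0$. -/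

import Mathlib

section GroupoidOrbit

variable {H : Type*} [NormedAddCommGroup H] [InnerProductSpace ℂ H] [CompleteSpace H]

/-- A bounded operator `v` is a partial isometry if `v* v` is an orthogonal projection. -/
def IsPartialIsometry (v : H →L[ℂ] H) : Prop :=
  IsStarProjection (star v * v)

/-- The range projection `p_y`: the orthogonal projection onto the closure of the range of `y`. -/
noncomputable def rangeProjection (y : H →L[ℂ] H) : H →L[ℂ] H :=
  y.range.topologicalClosure.starProjection

/-- The arrows `(v, y)` of the action groupoid of the partial isometries acting on the normal
operators: `v` is a partial isometry with initial projection `v* v = p_y`, `y` is normal. -/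
def IsActionArrow (v y : H →L[ℂ] H) : Prop :=
  IsPartialIsometry v ∧ IsStarNormal y ∧ star v * v = rangeProjection y

/-- The groupoid orbit of `a`: all targets `v a v*` of arrows `(v, a)` with source `a`. -/
def groupoidOrbit (a : H →L[ℂ] H) : Set (H →L[ℂ] H) :=
  {b | ∃ v : H →L[ℂ] H, IsActionArrow v a ∧ b = v * a * star v}

end GroupoidOrbit

section

open ContinuousLinearMap

theorem Orthonormal.countable_of_separable {E : Type*} [NormedAddCommGroup E]
    [InnerProductSpace ℂ E] [TopologicalSpace.SeparableSpace E] {ι : Type*} {v : ι → E}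
    (hv : Orthonormal ℂ v) : Countable ι := by
  have hd : Set.PairwiseDisjoint (Set.univ : Set ι) fun i => Metric.ball (v i) (1 / 2) := by
    intro i _ j _ hij
    refine Metric.ball_disjoint_ball ?_
    have h2 : ‖v i - v j‖ ^ 2 = 2 := by
      rw [@norm_sub_sq ℂ, hv.1 i, hv.1 j, hv.2 hij]; norm_num
    rw [dist_eq_norm]
    nlinarith [norm_nonneg (v i - v j)]
  have := hd.countable_of_isOpen (fun _ _ => Metric.isOpen_ball)
    (fun i _ => ⟨v i, Metric.mem_ball_self (by norm_num)⟩)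
  exact Set.countable_univ_iff.mp this

/-- Two infinite-dimensional separable Hilbert spaces are isometrically isomorphic. -/
theorem nonempty_linearIsometryEquiv_of_infinite {E F : Type*}
    [NormedAddCommGroup E] [InnerProductSpace ℂ E] [CompleteSpace E]
    [TopologicalSpace.SeparableSpace E]
    [NormedAddCommGroup F] [InnerProductSpace ℂ F] [CompleteSpace F]
    [TopologicalSpace.SeparableSpace F]
    (hE : ¬ FiniteDimensional ℂ E) (hF : ¬ FiniteDimensional ℂ F) :
    Nonempty (E ≃ₗᵢ[ℂ] F) := by
  obtain ⟨s, bE, -⟩ := exists_hilbertBasis ℂ E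
  obtain ⟨t, bF, -⟩ := exists_hilbertBasis ℂ F
  have := bE.orthonormal.countable_of_separable
  have := bF.orthonormal.countable_of_separable
  have : Infinite s := by
    by_contra h
    have := not_infinite_iff_finite.mp h
    have := Fintype.ofFinite s
    exact hE (bE.toOrthonormalBasis.toBasis.finiteDimensional_of_finite)
  have : Infinite t := by
    by_contra h
    have := not_infinite_iff_finite.mp h
    have := Fintype.ofFinite t
    exact hF (bF.toOrthonormalBasis.toBasis.finiteDimensional_of_finite)
  obtain ⟨e⟩ : Nonempty (s ≃ t) := nonempty_equiv_of_countable
  have hspan : ⊤ ≤ (Submodule.span ℂ (Set.range (bF ∘ e))).topologicalClosure := by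
    rw [e.surjective.range_comp, bF.dense_span]
  exact ⟨bE.repr.trans
    (HilbertBasis.mk (bF.orthonormal.comp e e.injective) hspan).repr.symm⟩

/-- A Cantor–Bernstein theorem for separable Hilbert spaces. -/
theorem nonempty_linearIsometryEquiv_of_injective {E F : Type*}
    [NormedAddCommGroup E] [InnerProductSpace ℂ E] [CompleteSpace E]
    [TopologicalSpace.SeparableSpace E]
    [NormedAddCommGroup F] [InnerProductSpace ℂ F] [CompleteSpace F]
    [TopologicalSpace.SeparableSpace F]
    (f : E →ₗ[ℂ] F) (hf : Function.Injective f) (g : F →ₗ[ℂ] E) (hg : Function.Injective g) :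
    Nonempty (E ≃ₗᵢ[ℂ] F) := by
  by_cases hE : FiniteDimensional ℂ E
  · have hF : FiniteDimensional ℂ F := FiniteDimensional.of_injective g hg
    have h : Module.finrank ℂ E = Module.finrank ℂ F :=
      le_antisymm (LinearMap.finrank_le_finrank_of_injective hf)
        (LinearMap.finrank_le_finrank_of_injective hg)
    exact ⟨(stdOrthonormalBasis ℂ E).equiv (stdOrthonormalBasis ℂ F) (finCongr h)⟩
  · exact nonempty_linearIsometryEquiv_of_infinite hE
      fun hF => hE (FiniteDimensional.of_injective f hf)

section Operators

variable {H : Type*} [NormedAddCommGroup H] [InnerProductSpace ℂ H] [CompleteSpace H]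

/-- An isometric isomorphism of closed subspaces extends to a partial isometry. -/
theorem exists_partialIsometry (M N : Submodule ℂ H) [CompleteSpace M] [CompleteSpace N]
    (W : M ≃ₗᵢ[ℂ] N) :
    ∃ w : H →L[ℂ] H, star w * w = M.starProjection ∧ w * star w = N.starProjection := by
  let w : H →L[ℂ] H := N.subtypeL ∘L (W : M →L[ℂ] N) ∘L M.orthogonalProjectionOnto
  have hw : star w = M.subtypeL ∘L (W.symm : N →L[ℂ] M) ∘L N.orthogonalProjectionOnto := by
    have hW : adjoint (W : M →L[ℂ] N) = (W.symm : N →L[ℂ] M) := W.adjoint_eq_symm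
    rw [star_eq_adjoint, adjoint_comp, adjoint_comp, Submodule.adjoint_subtypeL,
      Submodule.adjoint_orthogonalProjectionOnto, hW]
    rfl
  refine ⟨w, ?_, ?_⟩ <;> rw [hw] <;> ext x <;> simp [w]

theorem norm_le_one_of_star_mul_self_eq_starProjection {w : H →L[ℂ] H} {M : Submodule ℂ H}
    [M.HasOrthogonalProjection] (h : star w * w = M.starProjection) : ‖w‖ ≤ 1 := by
  have h1 : ‖w‖ * ‖w‖ ≤ 1 := by
    rw [← CStarRing.norm_star_mul_self, h]
    exact M.starProjection_norm_le
  nlinarith [norm_nonneg w]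

theorem mul_eq_self_of_star_mul_self_eq {v p : H →L[ℂ] H} (hp : IsStarProjection p)
    (h : star v * v = p) : v * p = v := by
  have : star (v - v * p) * (v - v * p) = 0 := by
    have hs : star p = p := hp.isSelfAdjoint
    have hi : p * p = p := hp.isIdempotentElem
    calc star (v - v * p) * (v - v * p)
        = star v * v - star v * v * p - star p * (star v * v) + star p * (star v * v) * p := by
          simp only [star_sub, star_mul]; noncomm_ring
      _ = 0 := by rw [h, hs, hi, hi]; simp
  exact (sub_eq_zero.mp (CStarRing.star_mul_self_eq_zero_iff _ |>.mp this)).symm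

end Operators

section Operators

variable {H : Type*} [NormedAddCommGroup H] [InnerProductSpace ℂ H]

/-- The eigenspace of the bounded operator `c` for the scalar `z` (trivial if `z` is not an
eigenvalue). -/
def eigSpace (c : H →L[ℂ] H) (z : ℂ) : Submodule ℂ H := (c - z • (1 : H →L[ℂ] H)).ker

theorem mem_eigSpace {c : H →L[ℂ] H} {z : ℂ} {x : H} : x ∈ eigSpace c z ↔ c x = z • x := by
  simp [eigSpace, sub_eq_zero]

theorem notMem_spectrum_iff_isUnit_sub {a : H →L[ℂ] H} {z : ℂ} :
    z ∉ spectrum ℂ a ↔ IsUnit (a - z • (1 : H →L[ℂ] H)) := by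
  rw [spectrum.notMem_iff, Algebra.algebraMap_eq_smul_one, ← IsUnit.neg_iff, neg_sub]

variable [CompleteSpace H]

instance (c : H →L[ℂ] H) (z : ℂ) : CompleteSpace (eigSpace c z) :=
  (ContinuousLinearMap.isClosed_ker (c - z • (1 : H →L[ℂ] H))).completeSpace_coe

theorem star_apply_of_mem_eigSpace {c : H →L[ℂ] H} (hc : IsStarNormal c) {z : ℂ} {x : H}
    (hx : x ∈ eigSpace c z) : star c x = star z • x := by
  have hn : IsStarNormal (c - z • (1 : H →L[ℂ] H)) := by
    constructor
    have h1 : star c * c = c * star c := hc.star_comm_self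
    change star (c - z • (1 : H →L[ℂ] H)) * (c - z • 1) = (c - z • 1) * star (c - z • 1)
    simp only [star_sub, star_smul, star_one, mul_sub, sub_mul, h1, mul_smul_comm, smul_mul_assoc,
      mul_one, one_mul, smul_sub, smul_comm z]
    abel
  have h := (ContinuousLinearMap.isStarNormal_iff_norm_eq_adjoint.mp hn x)
  rw [← star_eq_adjoint] at h
  have h0 : (c - z • (1 : H →L[ℂ] H)) x = 0 := hx
  rw [h0, norm_zero] at h
  have h1 := norm_eq_zero.mp h.symm
  simpa [sub_eq_zero] using h1

theorem eigSpace_orthogonal {c : H →L[ℂ] H} (hc : IsStarNormal c) {z w : ℂ} (hzw : z ≠ w) {x y : H}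
    (hx : x ∈ eigSpace c z) (hy : y ∈ eigSpace c w) : inner ℂ x y = 0 := by
  have h1 : inner ℂ (star c x) y = inner ℂ x (c y) := by
    rw [star_eq_adjoint, adjoint_inner_left]
  rw [star_apply_of_mem_eigSpace hc hx, mem_eigSpace.mp hy, inner_smul_left, inner_smul_right] at h1
  simp only [RCLike.star_def, RCLike.conj_conj] at h1
  by_contra h
  exact hzw (mul_right_cancel₀ h h1)

theorem isStarProjection_rangeProjection (a : H →L[ℂ] H) : IsStarProjection (rangeProjection a) :=
  isStarProjection_starProjection

theorem rangeProjection_mul_self (a : H →L[ℂ] H) : rangeProjection a * a = a := by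
  ext x
  exact Submodule.starProjection_eq_self_iff.mpr
    (Submodule.le_topologicalClosure _ ⟨x, rfl⟩)

theorem self_mul_rangeProjection {a : H →L[ℂ] H} (ha : IsStarNormal a) :
    a * rangeProjection a = a := by
  ext x
  have h1 : star a * rangeProjection a = star a := by
    have := congrArg star (rangeProjection_mul_self a)
    rwa [star_mul, (isStarProjection_rangeProjection a).isSelfAdjoint.star_eq] at this
  have h2 : star a (x - rangeProjection a x) = 0 := by
    rw [map_sub, ← mul_apply_eq_comp, h1, sub_self]
  have h3 := ContinuousLinearMap.isStarNormal_iff_norm_eq_adjoint.mp ha (x - rangeProjection a x)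
  rw [← star_eq_adjoint, h2, norm_zero] at h3
  have h4 := norm_eq_zero.mp h3
  rw [map_sub, sub_eq_zero] at h4
  exact h4.symm

theorem rangeProjection_apply_of_mem_eigSpace {a : H →L[ℂ] H} {z : ℂ} (hz : z ≠ 0) {x : H}
    (hx : x ∈ eigSpace a z) : rangeProjection a x = x := by
  refine Submodule.starProjection_eq_self_iff.mpr
    (Submodule.le_topologicalClosure _ ⟨z⁻¹ • x, ?_⟩)
  simp [mem_eigSpace.mp hx, smul_smul, hz]

theorem IsActionArrow.mul_rangeProjection {v a : H →L[ℂ] H} (h : IsActionArrow v a) :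
    v * rangeProjection a = v :=
  mul_eq_self_of_star_mul_self_eq (isStarProjection_rangeProjection a) h.2.2

theorem IsActionArrow.star_mul_mul_star {v a : H →L[ℂ] H} (h : IsActionArrow v a) :
    star v * v * star v = star v := by
  have := congrArg star h.mul_rangeProjection
  rwa [star_mul, (isStarProjection_rangeProjection a).isSelfAdjoint.star_eq, ← h.2.2] at this

theorem IsActionArrow.mul_mem_eigSpace {v a : H →L[ℂ] H} (h : IsActionArrow v a) {z : ℂ}
    (hz : z ≠ 0) {x : H} (hx : x ∈ eigSpace a z) : v x ∈ eigSpace (v * a * star v) z := by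
  rw [mem_eigSpace]
  have h1 : star v (v x) = x := by
    rw [← mul_apply_eq_comp, h.2.2, rangeProjection_apply_of_mem_eigSpace hz hx]
  simp [h1, mem_eigSpace.mp hx]

theorem IsActionArrow.eq_zero_of_apply_eq_zero {v a : H →L[ℂ] H} (h : IsActionArrow v a) {z : ℂ}
    (hz : z ≠ 0) {x : H} (hx : x ∈ eigSpace a z) (h0 : v x = 0) : x = 0 := by
  rw [← rangeProjection_apply_of_mem_eigSpace hz hx, ← h.2.2, mul_apply_eq_comp, h0,
    map_zero]

theorem IsActionArrow.star_mul_mem_eigSpace {v a : H →L[ℂ] H} (h : IsActionArrow v a) {z : ℂ}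
    {y : H} (hy : y ∈ eigSpace (v * a * star v) z) :
    star v y ∈ eigSpace a z := by
  rw [mem_eigSpace] at hy ⊢
  rw [← map_smul, ← hy]
  simp only [← mul_apply_eq_comp]
  congr 1
  rw [← mul_assoc, ← mul_assoc, h.2.2, rangeProjection_mul_self]

theorem eq_zero_of_star_apply_eq_zero {v a : H →L[ℂ] H} {z : ℂ} (hz : z ≠ 0)
    {y : H} (hy : y ∈ eigSpace (v * a * star v) z) (h0 : star v y = 0) : y = 0 := by
  rw [mem_eigSpace, mul_apply_eq_comp, h0, map_zero] at hy
  exact (smul_eq_zero.mp hy.symm).resolve_left hz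

theorem isClosed_setOf_isStarNormal : IsClosed {b : H →L[ℂ] H | IsStarNormal b} := by
  have : {b : H →L[ℂ] H | IsStarNormal b} = {b | star b * b = b * star b} := by
    ext b; exact ⟨fun h => h.star_comm_self, fun h => ⟨h⟩⟩
  rw [this]
  exact isClosed_eq (by fun_prop) (by fun_prop)

theorem IsActionArrow.isStarNormal {v a : H →L[ℂ] H} (h : IsActionArrow v a) :
    IsStarNormal (v * a * star v) := by
  constructor
  have h1 : star a * a = a * star a := h.2.1.star_comm_self
  have h2 := self_mul_rangeProjection h.2.1
  have h3 := congrArg star (rangeProjection_mul_self a)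
  rw [star_mul, (isStarProjection_rangeProjection a).isSelfAdjoint.star_eq] at h3
  change star (v * a * star v) * (v * a * star v) = v * a * star v * star (v * a * star v)
  calc _ = v * (star a * (star v * v)) * a * star v := by simp only [star_mul, star_star, mul_assoc]
    _ = v * (a * (star v * v)) * star a * star v := by
      rw [h.2.2, h2, h3, mul_assoc v, h1, ← mul_assoc v]
    _ = _ := by simp only [star_mul, star_star, mul_assoc]

theorem continuousOn_update_const {S : Set ℂ} {z : ℂ} (hz : ¬ AccPt z (Filter.principal S))
    {f : ℂ → ℂ} (hf : ContinuousOn f {z}ᶜ) : ContinuousOn f S := by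
  intro w _
  by_cases h : w = z
  · exact h ▸ continuousWithinAt_of_not_accPt (h ▸ hz)
  · exact (hf.continuousAt (isOpen_compl_singleton.mem_nhds h)).continuousWithinAt

theorem continuousOn_indicator_singleton {S : Set ℂ} {z : ℂ}
    (hz : ¬ AccPt z (Filter.principal S)) :
    ContinuousOn (fun w : ℂ => if w = z then (1 : ℂ) else 0) S := by
  refine continuousOn_update_const hz ?_
  exact (continuousOn_const (c := (0 : ℂ))).congr fun w hw => if_neg hw

theorem cfc_sub_const_id {c : H →L[ℂ] H} (hc : IsStarNormal c) (z : ℂ) :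
    cfc (fun w : ℂ => w - z) c = c - z • (1 : H →L[ℂ] H) := by
  rw [cfc_sub (fun w : ℂ => w) (fun _ => z) c, cfc_id' ℂ c, cfc_const z c,
    Algebra.algebraMap_eq_smul_one]

/-- At a point `z` which is not an accumulation point of the spectrum of `c`, the spectral
projection is the projection onto the eigenspace, and `c - z` is invertible off the eigenspace. -/
theorem cfc_indicator_singleton {c : H →L[ℂ] H} (hc : IsStarNormal c) {z : ℂ}
    (hz : ¬ AccPt z (Filter.principal (spectrum ℂ c))) :
    cfc (fun w : ℂ => if w = z then (1 : ℂ) else 0) c = (eigSpace c z).starProjection ∧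
      ∃ r : H →L[ℂ] H, r * (c - z • 1) = 1 - (eigSpace c z).starProjection := by
  have hf := continuousOn_indicator_singleton hz
  have hg : ContinuousOn (fun w : ℂ => (w - z)⁻¹) (spectrum ℂ c) := by
    refine continuousOn_update_const hz ?_
    exact ContinuousOn.inv₀ (by fun_prop) fun w hw => sub_ne_zero.mpr hw
  set f := cfc (fun w : ℂ => if w = z then (1 : ℂ) else 0) c with hfdef
  set r := cfc (fun w : ℂ => (w - z)⁻¹) c with hrdef
  have hcz := cfc_sub_const_id hc z
  have hr : r * (c - z • 1) = 1 - f := by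
    rw [← hcz, ← cfc_mul (fun w : ℂ => (w - z)⁻¹) (fun w => w - z) c, ← cfc_const_one ℂ c,
      ← cfc_sub (fun _ : ℂ => (1 : ℂ)) _ c]
    refine cfc_congr fun w _ => ?_
    by_cases h : w = z
    · simp [h]
    · simp [h, sub_ne_zero.mpr h]
  have hk : (c - z • 1) * f = 0 := by
    rw [← hcz, ← cfc_mul (fun w : ℂ => w - z) _ c, ← cfc_const_zero ℂ c]
    refine cfc_congr fun w _ => ?_
    by_cases h : w = z <;> simp [h]
  have hs : star f = f := by
    rw [hfdef, ← cfc_star]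
    refine cfc_congr fun w _ => ?_
    by_cases h : w = z <;> simp [h]
  have hmem : ∀ x, f x ∈ eigSpace c z := fun x => by
    change ((c - z • 1) * f) x = 0
    rw [hk]; rfl
  have hE : f = (eigSpace c z).starProjection := by
    ext x
    refine (Submodule.eq_starProjection_of_mem_of_inner_eq_zero (hmem x) fun y hy => ?_).symm
    have hy' : f y = y := by
      have := congrArg (fun T : H →L[ℂ] H => T y) hr
      have h0 : (c - z • (1 : H →L[ℂ] H)) y = 0 := hy
      simp only [mul_apply_eq_comp, h0, map_zero] at this
      exact (sub_eq_zero.mp this.symm).symm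
    have h2 : inner ℂ (f x) y = inner ℂ x (f y) := by
      conv_lhs => rw [← hs, star_eq_adjoint, adjoint_inner_left]
    rw [inner_sub_left, h2, hy', sub_self]
  exact ⟨hE, r, hE ▸ hr⟩

theorem apply_eq_zero_of_starProjection_eigSpace_eq_zero {c : H →L[ℂ] H} (hc : IsStarNormal c)
    (hacc : ∀ z : ℂ, AccPt z (Filter.principal (spectrum ℂ c)) → z = 0) {x : H}
    (hx : ∀ z : ℂ, z ≠ 0 → (eigSpace c z).starProjection x = 0) : c x = 0 := by
  classical
  refine norm_le_zero_iff.mp (le_of_forall_pos_le_add fun η hη => ?_)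
  obtain ⟨ε, hε, hεη⟩ : ∃ ε > 0, ε * ‖x‖ ≤ η := by
    refine ⟨η / (‖x‖ + 1), by positivity, ?_⟩
    rw [div_mul_eq_mul_div, div_le_iff₀ (by positivity)]
    nlinarith [norm_nonneg x]
  set S : Set ℂ := spectrum ℂ c ∩ {w | ε ≤ ‖w‖} with hS
  have hcl : IsClosed {w : ℂ | ε ≤ ‖w‖} := isClosed_le continuous_const continuous_norm
  have hfin : S.Finite := by
    by_contra hinf
    obtain ⟨w, hw, hacc'⟩ := Set.Infinite.exists_accPt_of_subset_isCompact hinf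
      ((spectrum.isCompact c).inter_right hcl) subset_rfl
    have h0 := hacc w (hacc'.mono (Filter.principal_mono.mpr Set.inter_subset_left))
    have := hw.2
    simp only [h0, Set.mem_ofPred_eq, norm_zero] at this
    linarith
  have hne : ∀ w ∈ hfin.toFinset, w ≠ 0 := by
    rintro w hw rfl
    have := ((Set.Finite.mem_toFinset hfin).mp hw).2
    simp only [Set.mem_ofPred_eq, norm_zero] at this
    linarith
  let f : ℂ → ℂ → ℂ := fun z w => z * (if w = z then 1 else 0)
  have hf1 : ∀ z ∈ hfin.toFinset, ContinuousOn (f z) (spectrum ℂ c) := fun z hz =>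
    continuousOn_const.mul
      (continuousOn_indicator_singleton fun h => hne z hz (hacc z h))
  have hsum : cfc (fun w => ∑ z ∈ hfin.toFinset, f z w) c =
      ∑ z ∈ hfin.toFinset, z • (eigSpace c z).starProjection := by
    rw [← Finset.sum_fn, cfc_sum f c hfin.toFinset hf1]
    refine Finset.sum_congr rfl fun z hz => ?_
    have hz' : ¬ AccPt z (Filter.principal (spectrum ℂ c)) := fun h => hne z hz (hacc z h)
    rw [← (cfc_indicator_singleton hc hz').1,
      cfc_const_mul z _ c (continuousOn_indicator_singleton hz')]
  have hsc : ContinuousOn (fun w => ∑ z ∈ hfin.toFinset, f z w) (spectrum ℂ c) :=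
    continuousOn_finsetSum _ hf1
  have hnorm : ‖c - ∑ z ∈ hfin.toFinset, z • (eigSpace c z).starProjection‖ ≤ ε := by
    have hsub := cfc_sub (fun w : ℂ => w) (fun w => ∑ z ∈ hfin.toFinset, f z w) c
      continuousOn_id hsc
    rw [cfc_id' ℂ c] at hsub
    rw [← hsum, ← hsub]
    refine norm_cfc_le hε.le fun w hw => ?_
    simp only [f, mul_ite, mul_one, mul_zero, Finset.sum_ite_eq]
    split_ifs with h
    · simpa using hε.le
    · rw [sub_zero]
      by_contra hlt
      exact h ((Set.Finite.mem_toFinset hfin).mpr ⟨hw, (not_le.mp hlt).le⟩)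
  have happ : c x = (c - ∑ z ∈ hfin.toFinset, z • (eigSpace c z).starProjection) x := by
    rw [sub_apply, sum_apply, Finset.sum_eq_zero, sub_zero]
    intro z hz
    rw [smul_apply, hx z (hne z hz), smul_zero]
  rw [happ, zero_add]
  exact ((le_opNorm _ x).trans (by gcongr)).trans hεη

end Operators

section Operators

variable {H : Type*} [NormedAddCommGroup H] [InnerProductSpace ℂ H] [CompleteSpace H]

theorem IsActionArrow.norm_le_one {v a : H →L[ℂ] H} (h : IsActionArrow v a) : ‖v‖ ≤ 1 :=
  norm_le_one_of_star_mul_self_eq_starProjection h.2.2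

/-- The conjugate by an arrow `v` of an approximate inverse `r` of `a - z`, extended by the scalar
`-z⁻¹` to the complement of the range of `v`. -/
noncomputable def conjResolvent (v r : H →L[ℂ] H) (z : ℂ) : H →L[ℂ] H :=
  v * r * star v - z⁻¹ • (1 - v * star v)

theorem IsActionArrow.norm_conjResolvent_le {v a : H →L[ℂ] H} (h : IsActionArrow v a)
    (r : H →L[ℂ] H) (z : ℂ) : ‖conjResolvent v r z‖ ≤ ‖r‖ + 2 * ‖z⁻¹‖ := by
  have hv := h.norm_le_one
  have hv' : ‖star v‖ ≤ 1 := by rwa [norm_star]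
  have h1 : ‖v * r * star v‖ ≤ ‖r‖ :=
    calc _ ≤ ‖v‖ * ‖r‖ * ‖star v‖ :=
          (norm_mul_le _ _).trans (mul_le_mul_of_nonneg_right (norm_mul_le _ _) (norm_nonneg _))
      _ ≤ 1 * ‖r‖ * 1 := by gcongr
      _ = ‖r‖ := by ring
  have h2 : ‖(1 : H →L[ℂ] H) - v * star v‖ ≤ 2 :=
    calc _ ≤ ‖(1 : H →L[ℂ] H)‖ + ‖v‖ * ‖star v‖ :=
          (norm_sub_le _ _).trans (add_le_add_right (norm_mul_le _ _) _)
      _ ≤ 1 + 1 * 1 := by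
        gcongr
        exact ContinuousLinearMap.norm_id_le
      _ = 2 := by norm_num
  calc _ ≤ ‖v * r * star v‖ + ‖z⁻¹‖ * ‖(1 : H →L[ℂ] H) - v * star v‖ :=
        (norm_sub_le _ _).trans (add_le_add_right (norm_smul_le _ _) _)
    _ ≤ ‖r‖ + ‖z⁻¹‖ * 2 := by gcongr
    _ = _ := by ring

theorem IsActionArrow.conjResolvent_mul {v a : H →L[ℂ] H} (h : IsActionArrow v a)
    (r : H →L[ℂ] H) {z : ℂ} (hz : z ≠ 0) :
    conjResolvent v r z * (v * a * star v - z • 1) =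
      v * (r * (a - z • 1)) * star v + (1 - v * star v) := by
  have h1 : v * r * star v * (v * a * star v) = v * r * a * star v := by
    calc _ = v * r * ((star v * v) * a) * star v := by simp only [mul_assoc]
      _ = _ := by rw [h.2.2, rangeProjection_mul_self]
  have h2 : v * star v * (v * a * star v) = v * a * star v := by
    calc _ = v * (star v * v) * a * star v := by simp only [mul_assoc]
      _ = _ := by rw [h.2.2, h.mul_rangeProjection]
  simp only [conjResolvent, sub_mul, mul_sub, smul_mul_assoc, mul_smul_comm, mul_one, one_mul, h1,
    h2, smul_sub, smul_smul, mul_inv_cancel₀ hz, one_smul, sub_self]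
  simp only [mul_assoc]
  abel

theorem IsActionArrow.mul_conjResolvent {v a : H →L[ℂ] H} (h : IsActionArrow v a)
    (r : H →L[ℂ] H) {z : ℂ} (hz : z ≠ 0) :
    (v * a * star v - z • 1) * conjResolvent v r z =
      v * ((a - z • 1) * r) * star v + (1 - v * star v) := by
  have h1 : v * a * star v * (v * r * star v) = v * a * r * star v := by
    calc _ = v * (a * (star v * v)) * r * star v := by simp only [mul_assoc]
      _ = _ := by rw [h.2.2, self_mul_rangeProjection h.2.1]
  have h2 : v * a * star v * (v * star v) = v * a * star v := by
    calc _ = v * a * (star v * v * star v) := by simp only [mul_assoc]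
      _ = _ := by rw [h.star_mul_mul_star]
  simp only [conjResolvent, sub_mul, mul_sub, smul_mul_assoc, mul_smul_comm, mul_one, one_mul, h1,
    h2, smul_sub, smul_smul, inv_mul_cancel₀ hz, one_smul]
  simp only [mul_assoc]
  abel

theorem mem_closure_groupoidOrbit_iff {a b : H →L[ℂ] H} :
    b ∈ closure (groupoidOrbit a) ↔
      ∀ ε > 0, ∃ v : H →L[ℂ] H, IsActionArrow v a ∧ ‖b - v * a * star v‖ < ε := by
  simp only [Metric.mem_closure_iff, groupoidOrbit, Set.mem_ofPred_eq, dist_eq_norm]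
  constructor
  · intro h ε hε
    obtain ⟨_, ⟨v, hv, rfl⟩, hb⟩ := h ε hε
    exact ⟨v, hv, hb⟩
  · intro h ε hε
    obtain ⟨v, hv, hb⟩ := h ε hε
    exact ⟨_, ⟨v, hv, rfl⟩, hb⟩

theorem exists_isActionArrow_mul_norm_lt {a b : H →L[ℂ] H} (hb : b ∈ closure (groupoidOrbit a))
    {C : ℝ} (hC : 0 ≤ C) :
    ∃ v : H →L[ℂ] H, IsActionArrow v a ∧ C * ‖b - v * a * star v‖ < 1 := by
  obtain ⟨v, hv, hlt⟩ := mem_closure_groupoidOrbit_iff.mp hb (1 / (C + 1)) (by positivity)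
  refine ⟨v, hv, ?_⟩
  rw [lt_div_iff₀ (by positivity)] at hlt
  nlinarith [norm_nonneg (b - v * a * star v)]

theorem spectrum_subset_of_mem_closure_groupoidOrbit {a b : H →L[ℂ] H}
    (hb : b ∈ closure (groupoidOrbit a)) {z : ℂ} (hz : z ≠ 0) (hzb : z ∈ spectrum ℂ b) :
    z ∈ spectrum ℂ a := by
  by_contra hza
  obtain ⟨u, hu⟩ := notMem_spectrum_iff_isUnit_sub.mp hza
  set r : H →L[ℂ] H := ((u⁻¹ : (H →L[ℂ] H)ˣ) : H →L[ℂ] H)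
  obtain ⟨v, hv, hlt⟩ := exists_isActionArrow_mul_norm_lt hb
    (C := ‖r‖ + 2 * ‖z⁻¹‖) (by positivity)
  have hR := hv.norm_conjResolvent_le r z
  have h1 := hv.conjResolvent_mul r hz
  have h2 := hv.mul_conjResolvent r hz
  rw [← hu, Units.inv_mul, mul_one, add_sub_cancel] at h1
  rw [← hu, Units.mul_inv, mul_one, add_sub_cancel] at h2
  have hlt1 : ‖conjResolvent v r z * (v * a * star v - b)‖ < 1 := by
    refine (norm_mul_le _ _).trans_lt (lt_of_le_of_lt ?_ hlt)
    rw [norm_sub_rev b]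
    gcongr
  have h3 : b - z • 1 = (v * a * star v - z • 1) *
      (1 - conjResolvent v r z * (v * a * star v - b)) := by
    rw [mul_sub, ← mul_assoc, h2]
    noncomm_ring
  refine notMem_spectrum_iff_isUnit_sub.mpr ?_ hzb
  rw [h3]
  exact (isUnit_iff_exists.mpr ⟨_, h2, h1⟩).mul (isUnit_one_sub_of_norm_lt_one hlt1)

theorem eigSpace_linearIsometryEquiv_of_mem_closure_groupoidOrbit
    [TopologicalSpace.SeparableSpace H] {a b : H →L[ℂ] H} (ha : IsStarNormal a)
    (hbn : IsStarNormal b) (hb : b ∈ closure (groupoidOrbit a)) {z : ℂ} (hz : z ≠ 0)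
    (hza : ¬ AccPt z (Filter.principal (spectrum ℂ a)))
    (hzb : ¬ AccPt z (Filter.principal (spectrum ℂ b))) :
    Nonempty (eigSpace a z ≃ₗᵢ[ℂ] eigSpace b z) := by
  obtain ⟨-, r, hr⟩ := cfc_indicator_singleton ha hza
  obtain ⟨-, s, hs⟩ := cfc_indicator_singleton hbn hzb
  obtain ⟨v, hv, hlt⟩ := exists_isActionArrow_mul_norm_lt hb
    (C := ‖r‖ + 2 * ‖z⁻¹‖) (by positivity)
  obtain ⟨w, hw, hlt'⟩ := exists_isActionArrow_mul_norm_lt hb (norm_nonneg s)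
  have zero_of {T : H →L[ℂ] H} {C : ℝ} {b' : H →L[ℂ] H} {x : H} (hT : ‖T‖ ≤ C)
      (hC : C * ‖b - b'‖ < 1) (hx : x = T ((b - b') x) ∨ x = -T ((b - b') x)) : x = 0 := by
    have h1 : ‖x‖ = ‖T ((b - b') x)‖ := by
      rcases hx with h | h
      · exact congrArg _ h
      · rw [← norm_neg (T _)]; exact congrArg _ h
    have h2 : ‖T ((b - b') x)‖ ≤ C * ‖b - b'‖ * ‖x‖ := by
      rw [mul_assoc]
      exact T.le_of_opNorm_le_of_le hT (le_opNorm _ _)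
    by_contra hne
    have := norm_pos_iff.mpr hne
    nlinarith
  refine nonempty_linearIsometryEquiv_of_injective
    ((eigSpace b z).orthogonalProjectionOnto.toLinearMap ∘ₗ w.toLinearMap ∘ₗ (eigSpace a z).subtype)
    ?_
    ((eigSpace a z).orthogonalProjectionOnto.toLinearMap ∘ₗ (star v).toLinearMap ∘ₗ
      (eigSpace b z).subtype) ?_
  · rw [injective_iff_map_eq_zero]
    rintro ⟨x, hx⟩ h0
    have h0' : (eigSpace b z).starProjection (w x) = 0 := by
      rw [Submodule.starProjection_apply]
      exact congrArg Subtype.val h0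
    have hwx : w x = 0 := by
      refine zero_of le_rfl hlt' (Or.inl ?_)
      have h1 := congrArg (fun T : H →L[ℂ] H => T (w x)) hs
      simp only [mul_apply_eq_comp, sub_apply, one_apply_eq_self, h0', sub_zero, smul_apply] at h1
      rw [sub_apply, mem_eigSpace.mp (hw.mul_mem_eigSpace hz hx)]
      exact h1.symm
    exact Subtype.ext (hw.eq_zero_of_apply_eq_zero hz hx hwx)
  · rw [injective_iff_map_eq_zero]
    rintro ⟨y, hy⟩ h0
    have h0' : (eigSpace a z).starProjection (star v y) = 0 := by
      rw [Submodule.starProjection_apply]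
      exact congrArg Subtype.val h0
    refine Subtype.ext (zero_of (hv.norm_conjResolvent_le r z) hlt (Or.inr ?_))
    have h1 := congrArg (fun T : H →L[ℂ] H => T y) (hv.conjResolvent_mul r hz)
    simp only [hr, mul_apply_eq_comp, sub_apply, add_apply, one_apply_eq_self, h0', sub_zero,
      smul_apply, add_sub_cancel] at h1
    simp only [sub_apply, mem_eigSpace.mp hy, mul_apply_eq_comp]
    rw [← map_neg, neg_sub]
    exact h1.symm

/-- The Hilbert sum of the eigenspaces of a normal operator for nonzero scalars is the closure of the
range, if the spectrum accumulates at most at `0`. -/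
theorem linearIsometry_mul_adjoint_eq_rangeProjection {c : H →L[ℂ] H} (hc : IsStarNormal c)
    (hacc : ∀ z : ℂ, AccPt z (Filter.principal (spectrum ℂ c)) → z = 0)
    {G : {z : ℂ // z ≠ 0} → Type*} [∀ z, NormedAddCommGroup (G z)]
    [∀ z, InnerProductSpace ℂ (G z)] [∀ z, CompleteSpace (G z)] {V : ∀ z, G z →ₗᵢ[ℂ] H}
    (hV : OrthogonalFamily ℂ G V)
    (hr : ∀ z, LinearMap.range (V z).toLinearMap = eigSpace c z) :
    hV.linearIsometry.toContinuousLinearMap ∘L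
      adjoint hV.linearIsometry.toContinuousLinearMap = rangeProjection c := by
  classical
  set A : lp G 2 →L[ℂ] H := hV.linearIsometry.toContinuousLinearMap with hA
  have hAA : adjoint A ∘L A = 1 :=
    (norm_map_iff_adjoint_comp_self A).mp hV.linearIsometry.norm_map
  ext x
  refine (Submodule.eq_starProjection_of_mem_orthogonal ?_ ?_).symm
  · have h1 : A (adjoint A x) ∈ LinearMap.range hV.linearIsometry.toLinearMap := ⟨adjoint A x, rfl⟩
    rw [hV.range_linearIsometry] at h1
    refine Submodule.topologicalClosure_mono (iSup_le fun z => ?_) h1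
    rw [hr z]
    intro y hy
    refine ⟨(z : ℂ)⁻¹ • y, ?_⟩
    simp [mem_eigSpace.mp hy, smul_smul, z.2]
  · rw [Submodule.orthogonal_closure]
    set y := x - (A ∘L adjoint A) x with hy
    have hAy : adjoint A y = 0 := by
      have := congrArg (fun T : lp G 2 →L[ℂ] lp G 2 => T (adjoint A x)) hAA
      simp only [comp_apply, one_apply_eq_self] at this
      rw [hy, map_sub, comp_apply, this, sub_self]
    have hcy : c y = 0 := by
      refine apply_eq_zero_of_starProjection_eigSpace_eq_zero hc hacc fun z hz => ?_
      rw [Submodule.starProjection_apply_eq_zero_iff, Submodule.mem_orthogonal]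
      intro w hw
      rw [← hr ⟨z, hz⟩] at hw
      obtain ⟨g, rfl⟩ := hw
      have h1 : A (lp.single 2 ⟨z, hz⟩ g) = V ⟨z, hz⟩ g := hV.linearIsometry_apply_single g
      change inner ℂ (V ⟨z, hz⟩ g) y = 0
      rw [← h1, ← adjoint_inner_right, hAy, inner_zero_right]
    have hcy' : star c y = 0 := by
      have := star_apply_of_mem_eigSpace hc (z := 0) (x := y) (mem_eigSpace.mpr (by simpa using hcy))
      simpa using this
    rw [Submodule.mem_orthogonal]
    rintro _ ⟨u, rfl⟩
    change inner ℂ (c u) y = 0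
    rw [← adjoint_inner_right, ← star_eq_adjoint, hcy', inner_zero_right]

/-- Two normal operators whose spectra accumulate at most at `0` and whose eigenspaces for nonzero
scalars are isometric lie in the same groupoid orbit. -/
theorem mem_groupoidOrbit_of_eigSpace_linearIsometryEquiv {a b : H →L[ℂ] H} (ha : IsStarNormal a)
    (hb : IsStarNormal b)
    (hacc : ∀ z : ℂ, AccPt z (Filter.principal (spectrum ℂ a)) → z = 0)
    (hbcc : ∀ z : ℂ, AccPt z (Filter.principal (spectrum ℂ b)) → z = 0)
    (hW : ∀ z : ℂ, z ≠ 0 → Nonempty (eigSpace a z ≃ₗᵢ[ℂ] eigSpace b z)) :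
    b ∈ groupoidOrbit a := by
  classical
  let G : {z : ℂ // z ≠ 0} → Type _ := fun z => eigSpace a z
  let W : ∀ z : {z : ℂ // z ≠ 0}, eigSpace a z ≃ₗᵢ[ℂ] eigSpace b z := fun z => (hW z z.2).some
  let Va : ∀ z, G z →ₗᵢ[ℂ] H := fun z => (eigSpace a z).subtypeₗᵢ
  let Vb : ∀ z, G z →ₗᵢ[ℂ] H := fun z => (eigSpace b z).subtypeₗᵢ.comp (W z).toLinearIsometry
  have hVa : OrthogonalFamily ℂ G Va := fun i j hij x y =>
    eigSpace_orthogonal ha (fun h => hij (Subtype.ext h)) x.2 y.2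
  have hVb : OrthogonalFamily ℂ G Vb := fun i j hij x y =>
    eigSpace_orthogonal hb (fun h => hij (Subtype.ext h)) (W i x).2 (W j y).2
  have hra : ∀ z, LinearMap.range (Va z).toLinearMap = eigSpace a z := fun z =>
    (eigSpace a z).range_subtype
  have hrb : ∀ z, LinearMap.range (Vb z).toLinearMap = eigSpace b z := by
    intro z
    ext y
    constructor
    · rintro ⟨x, rfl⟩
      exact (W z x).2
    · intro hy
      exact ⟨(W z).symm ⟨y, hy⟩, congrArg Subtype.val ((W z).apply_symm_apply ⟨y, hy⟩)⟩
  have hpa := linearIsometry_mul_adjoint_eq_rangeProjection ha hacc hVa hra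
  have hpb := linearIsometry_mul_adjoint_eq_rangeProjection hb hbcc hVb hrb
  have hsa : ∀ z (x : G z), hVa.linearIsometry.toContinuousLinearMap (lp.single 2 z x) = (x : H) :=
    fun z x => hVa.linearIsometry_apply_single x
  have hsb : ∀ z (x : G z),
      hVb.linearIsometry.toContinuousLinearMap (lp.single 2 z x) = (W z x : H) :=
    fun z x => hVb.linearIsometry_apply_single x
  have hAA := (norm_map_iff_adjoint_comp_self hVa.linearIsometry.toContinuousLinearMap).mp
    hVa.linearIsometry.norm_map
  have hBB := (norm_map_iff_adjoint_comp_self hVb.linearIsometry.toContinuousLinearMap).mp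
    hVb.linearIsometry.norm_map
  set A : lp G 2 →L[ℂ] H := hVa.linearIsometry.toContinuousLinearMap
  set B : lp G 2 →L[ℂ] H := hVb.linearIsometry.toContinuousLinearMap
  let v : H →L[ℂ] H := B ∘L adjoint A
  have hsv : star v = A ∘L adjoint B := by
    rw [star_eq_adjoint, adjoint_comp, adjoint_adjoint]
  have hvv : star v * v = rangeProjection a := by
    rw [hsv, ← hpa]
    change A ∘L (adjoint B ∘L B) ∘L adjoint A = _
    rw [hBB]; rfl
  have hvv' : v * star v = rangeProjection b := by
    rw [hsv, ← hpb]
    change B ∘L (adjoint A ∘L A) ∘L adjoint B = _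
    rw [hAA]; rfl
  have hvA : v ∘L A = B := by
    change B ∘L (adjoint A ∘L A) = _
    rw [hAA]; rfl
  have harr : IsActionArrow v a :=
    ⟨by rw [IsPartialIsometry, hvv]; exact isStarProjection_rangeProjection a, ha, hvv⟩
  have hint : b ∘L B = (v * a) ∘L A := by
    refine lp.ext_continuousLinearMap (by simp) fun z => ?_
    ext x
    have hx : v (x : H) = W z x := by
      rw [← hsa z x, ← hsb z x, ← hvA]; rfl
    have h1 : b (W z x : H) = (z : ℂ) • (W z x : H) := mem_eigSpace.mp (W z x).2
    have h2 : a (x : H) = (z : ℂ) • (x : H) := mem_eigSpace.mp x.2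
    change b (B (lp.single 2 z x)) = v (a (A (lp.single 2 z x)))
    rw [hsa, hsb, h1, h2, map_smul, hx]
  have hbv : b * v = v * a := by
    calc b * v = (b ∘L B) ∘L adjoint A := rfl
      _ = v * a * (A ∘L adjoint A) := by rw [hint]; rfl
      _ = v * a := by rw [hpa, mul_assoc, self_mul_rangeProjection ha]
  exact ⟨v, harr, by rw [← hbv, mul_assoc, hvv', self_mul_rangeProjection hb]⟩

theorem isClosed_groupoidOrbit [TopologicalSpace.SeparableSpace H] {a : H →L[ℂ] H}
    (ha : IsStarNormal a)
    (hacc : ∀ z : ℂ, AccPt z (Filter.principal (spectrum ℂ a)) → z = 0) :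
    IsClosed (groupoidOrbit a) := by
  refine isClosed_of_closure_subset fun b hb => ?_
  have hbn : IsStarNormal b := by
    refine closure_minimal ?_ isClosed_setOf_isStarNormal hb
    rintro _ ⟨v, hv, rfl⟩
    exact hv.isStarNormal
  have hbcc : ∀ z : ℂ, AccPt z (Filter.principal (spectrum ℂ b)) → z = 0 := by
    intro z hz
    by_contra h0
    refine h0 (hacc z ?_)
    rw [accPt_iff_nhds] at hz ⊢
    intro U hU
    obtain ⟨y, ⟨⟨hyU, hy0⟩, hyb⟩, hyz⟩ :=
      hz (U ∩ {0}ᶜ) (Filter.inter_mem hU (isOpen_compl_singleton.mem_nhds h0))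
    exact ⟨y, ⟨hyU, spectrum_subset_of_mem_closure_groupoidOrbit hb hy0 hyb⟩, hyz⟩
  exact mem_groupoidOrbit_of_eigSpace_linearIsometryEquiv ha hbn hacc hbcc fun z hz =>
    eigSpace_linearIsometryEquiv_of_mem_closure_groupoidOrbit ha hbn hb hz
      (fun h => hz (hacc z h)) (fun h => hz (hbcc z h))

end Operators

section Operators

variable {H : Type*} [NormedAddCommGroup H] [InnerProductSpace ℂ H] [CompleteSpace H]

theorem starProjection_mul_comm_of_mapsTo {c : H →L[ℂ] H} {M : Submodule ℂ H}
    [M.HasOrthogonalProjection] (h : ∀ x ∈ M, c x ∈ M) (h' : ∀ x ∈ M, star c x ∈ M) :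
    c * M.starProjection = M.starProjection * c := by
  have key : ∀ d : H →L[ℂ] H, (∀ x ∈ M, d x ∈ M) →
      M.starProjection * (d * M.starProjection) = d * M.starProjection := fun d hd => by
    ext x
    exact Submodule.starProjection_eq_self_iff.mpr (hd _ (Submodule.starProjection_apply_mem M x))
  have hs : star M.starProjection = M.starProjection :=
    isStarProjection_starProjection.isSelfAdjoint
  have h1 := key c h
  have h2 := congrArg star (key (star c) h')
  simp only [star_mul, hs, star_star] at h2
  rw [← h1, ← mul_assoc, h2]

theorem accPt_infinite_inter_ball {S : Set ℂ} {z : ℂ} (h : AccPt z (Filter.principal S)) {ε : ℝ}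
    (hε : 0 < ε) : (S ∩ Metric.ball z ε).Infinite := by
  have := h.nhds_inter (Metric.ball_mem_nhds z hε)
  rw [Set.inter_comm]
  exact Set.Infinite.of_accPt this

/-- The spectral subspace of a normal operator for the closed disc of radius `ε` about `z`. -/
noncomputable def discSubspace (c : H →L[ℂ] H) (z : ℂ) (ε : ℝ) : Submodule ℂ H :=
  (cfc (fun w : ℂ => (w - z) * (1 - (ε / max ε ‖w - z‖ : ℝ))) c).ker

instance (c : H →L[ℂ] H) (z : ℂ) (ε : ℝ) : CompleteSpace (discSubspace c z ε) :=
  (ContinuousLinearMap.isClosed_ker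
    (cfc (fun w : ℂ => (w - z) * (1 - (ε / max ε ‖w - z‖ : ℝ))) c)).completeSpace_coe

theorem continuous_div_max_norm {ε : ℝ} (hε : 0 < ε) (z : ℂ) :
    Continuous fun w : ℂ => ((ε / max ε ‖w - z‖ : ℝ) : ℂ) := by
  refine Complex.continuous_ofReal.comp (continuous_const.div (by fun_prop) fun w => ?_)
  exact (hε.trans_le (le_max_left _ _)).ne'

theorem apply_mem_discSubspace {c : H →L[ℂ] H} (hc : IsStarNormal c) (z : ℂ) (ε : ℝ) {x : H}
    (hx : x ∈ discSubspace c z ε) : c x ∈ discSubspace c z ε ∧ star c x ∈ discSubspace c z ε := by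
  set k := cfc (fun w : ℂ => (w - z) * (1 - (ε / max ε ‖w - z‖ : ℝ))) c with hk
  have h1 : k * c = c * k := by
    have := cfc_commute_cfc (fun w : ℂ => (w - z) * (1 - (ε / max ε ‖w - z‖ : ℝ))) id c
    rwa [cfc_id ℂ c] at this
  have h2 : k * star c = star c * k := by
    have := cfc_commute_cfc (fun w : ℂ => (w - z) * (1 - (ε / max ε ‖w - z‖ : ℝ))) (star ·) c
    rwa [cfc_star_id (a := c)] at this
  have hx' : k x = 0 := hx
  constructor
  · change (k * c) x = 0
    rw [h1, mul_apply_eq_comp, hx', map_zero]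
  · change (k * star c) x = 0
    rw [h2, mul_apply_eq_comp, hx', map_zero]

theorem norm_apply_le_of_mem_discSubspace {c : H →L[ℂ] H} (hc : IsStarNormal c) (z : ℂ) {ε : ℝ}
    (hε : 0 < ε) {x : H} (hx : x ∈ discSubspace c z ε) :
    ‖(c - z • (1 : H →L[ℂ] H)) x‖ ≤ ε * ‖x‖ := by
  have hcont := continuous_div_max_norm hε z
  have hsum : c - z • (1 : H →L[ℂ] H) =
      cfc (fun w : ℂ => (w - z) * ((ε / max ε ‖w - z‖ : ℝ) : ℂ)) c +
        cfc (fun w : ℂ => (w - z) * (1 - (ε / max ε ‖w - z‖ : ℝ))) c := by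
    rw [← cfc_add (a := c) _ _ (by fun_prop) (by fun_prop), ← cfc_sub_const_id hc]
    refine cfc_congr fun w _ => ?_
    ring
  have hx' : cfc (fun w : ℂ => (w - z) * (1 - (ε / max ε ‖w - z‖ : ℝ))) c x = 0 := hx
  rw [hsum, add_apply, hx', add_zero]
  refine le_of_opNorm_le _ (norm_cfc_le hε.le fun w _ => ?_) x
  have hpos : 0 < max ε ‖w - z‖ := hε.trans_le (le_max_left _ _)
  rw [norm_mul, Complex.norm_real, Real.norm_of_nonneg (by positivity), mul_div_assoc',
    div_le_iff₀ hpos, mul_comm]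
  gcongr
  exact le_max_right _ _

theorem eigSpace_le_discSubspace {c : H →L[ℂ] H} (hc : IsStarNormal c) (z : ℂ) {ε : ℝ}
    (hε : 0 < ε) : eigSpace c z ≤ discSubspace c z ε := by
  intro x hx
  have hcont := continuous_div_max_norm hε z
  have h1 : cfc (fun w : ℂ => (w - z) * (1 - (ε / max ε ‖w - z‖ : ℝ))) c =
      cfc (fun w : ℂ => 1 - ((ε / max ε ‖w - z‖ : ℝ) : ℂ)) c * (c - z • 1) := by
    rw [← cfc_sub_const_id hc, ← cfc_mul (fun w : ℂ => 1 - ((ε / max ε ‖w - z‖ : ℝ) : ℂ)) _ c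
      (continuous_const.sub hcont).continuousOn (by fun_prop)]
    refine cfc_congr fun w _ => ?_
    ring
  change cfc (fun w : ℂ => (w - z) * (1 - (ε / max ε ‖w - z‖ : ℝ))) c x = 0
  have hx' : (c - z • (1 : H →L[ℂ] H)) x = 0 := hx
  rw [h1, mul_apply_eq_comp, hx', map_zero]

/-- Near an accumulation point `z` of the spectrum, the spectral subspaces remain
infinite-dimensional after the eigenvectors for `z` are removed. -/
theorem not_finiteDimensional_discSubspace_inf {c : H →L[ℂ] H} (hc : IsStarNormal c) {z : ℂ}
    (hz : AccPt z (Filter.principal (spectrum ℂ c))) {ε : ℝ} (hε : 0 < ε) :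
    ¬ FiniteDimensional ℂ ↥(discSubspace c z ε ⊓ (eigSpace c z)ᗮ) := by
  intro hfin
  set N := discSubspace c z ε ⊓ (eigSpace c z)ᗮ with hN
  have hinv : ∀ x ∈ N, c x ∈ N := by
    rintro x ⟨hx1, hx2⟩
    refine ⟨(apply_mem_discSubspace hc z ε hx1).1, (Submodule.mem_orthogonal _ _).mpr fun y hy => ?_⟩
    rw [← adjoint_inner_left, ← star_eq_adjoint, star_apply_of_mem_eigSpace hc hy, inner_smul_left,
      (Submodule.mem_orthogonal _ _).mp hx2 y hy, mul_zero]
  let T : N →ₗ[ℂ] N := c.toLinearMap.restrict hinv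
  set p := minpoly ℂ T
  have hp0 : p ≠ 0 := minpoly.ne_zero (Algebra.IsIntegral.isIntegral T)
  have hT : ∀ (q : Polynomial ℂ) (x : N), (Polynomial.aeval c q) (x : H) =
      (Polynomial.aeval T q x : N) := by
    intro q x
    induction q using Polynomial.induction_on' with
    | add f g hf hg => simp [hf, hg]
    | monomial n α =>
      have : ∀ n : ℕ, ((c ^ n) (x : H)) = ((T ^ n) x : N) := by
        intro n
        induction n with
        | zero => simp
        | succ n ih =>
          rw [pow_succ', pow_succ', mul_apply_eq_comp, ih]
          rfl
      simp [Polynomial.aeval_monomial, this n, Algebra.algebraMap_eq_smul_one]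
  have hpN : ∀ x ∈ N, (Polynomial.aeval c p) x = 0 := fun x hx => by
    rw [hT p ⟨x, hx⟩, minpoly.aeval]; rfl
  let q : Polynomial ℂ := p * (Polynomial.X - Polynomial.C z)
  have hq0 : q ≠ 0 := mul_ne_zero hp0 (Polynomial.X_sub_C_ne_zero z)
  have hcz : Polynomial.aeval c (Polynomial.X - Polynomial.C z) = c - z • (1 : H →L[ℂ] H) := by
    simp [Algebra.algebraMap_eq_smul_one]
  have hqM : ∀ x ∈ discSubspace c z ε, (Polynomial.aeval c q) x = 0 := by
    intro x hx
    have hEx := Submodule.starProjection_apply_mem (eigSpace c z) x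
    have h1 : x - (eigSpace c z).starProjection x ∈ N :=
      ⟨sub_mem hx (eigSpace_le_discSubspace hc z hε hEx),
        Submodule.sub_starProjection_mem_orthogonal x⟩
    have h2 : (Polynomial.aeval c q) ((eigSpace c z).starProjection x) = 0 := by
      have h0 : (c - z • (1 : H →L[ℂ] H)) ((eigSpace c z).starProjection x) = 0 := hEx
      rw [map_mul, hcz, mul_apply_eq_comp, h0, map_zero]
    have h3 : (Polynomial.aeval c q) (x - (eigSpace c z).starProjection x) = 0 := by
      rw [show q = (Polynomial.X - Polynomial.C z) * p from mul_comm _ _, map_mul,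
        mul_apply_eq_comp, hpN _ h1, map_zero]
    rw [map_sub, h2, sub_zero] at h3
    exact h3
  let φ : ℂ → ℂ := fun w => ((max 0 (ε - ‖w - z‖) : ℝ) : ℂ)
  have hφ : Continuous φ := Complex.continuous_ofReal.comp (by fun_prop)
  have hcont := continuous_div_max_norm hε z
  have hφM : ∀ x, cfc φ c x ∈ discSubspace c z ε := by
    intro x
    have h0 : cfc (fun w : ℂ => (w - z) * (1 - (ε / max ε ‖w - z‖ : ℝ))) c * cfc φ c = 0 := by
      rw [← cfc_mul _ _ c (by fun_prop) hφ.continuousOn, ← cfc_const_zero ℂ c]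
      refine cfc_congr fun w _ => ?_
      rcases le_total ‖w - z‖ ε with h | h
      · simp [max_eq_left h, hε.ne']
      · simp [φ, max_eq_left (sub_nonpos.mpr h)]
    change (cfc (fun w : ℂ => (w - z) * (1 - (ε / max ε ‖w - z‖ : ℝ))) c * cfc φ c) x = 0
    rw [h0, zero_apply]
  have hzero : cfc (fun w => q.eval w * φ w) c = cfc (fun _ : ℂ => (0 : ℂ)) c := by
    rw [cfc_mul (fun w => q.eval w) φ c (by fun_prop) hφ.continuousOn, cfc_polynomial q c,
      cfc_const_zero]
    ext x
    exact hqM _ (hφM x)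
  have hroot : spectrum ℂ c ∩ Metric.ball z ε ⊆ {w | q.IsRoot w} := by
    rintro w ⟨hw, hwz⟩
    have h1 : q.eval w * φ w = 0 :=
      eqOn_of_cfc_eq_cfc hzero ((by fun_prop : Continuous fun w => q.eval w).mul hφ).continuousOn
        continuousOn_const hc hw
    have h2 : φ w ≠ 0 := by
      rw [Metric.mem_ball, dist_eq_norm] at hwz
      simp only [φ, ne_eq, Complex.ofReal_eq_zero]
      rw [max_eq_right (by linarith)]
      linarith
    exact (mul_eq_zero.mp h1).resolve_right h2
  exact accPt_infinite_inter_ball hz hε ((Polynomial.finite_setOfPred_isRoot hq0).subset hroot)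

/-- A normal operator is, up to isometries and small perturbations, independent of the multiplicity
of an eigenvalue which is an accumulation point of the spectrum. -/
theorem exists_isometry_norm_conj_sub_le [TopologicalSpace.SeparableSpace H] {c : H →L[ℂ] H}
    (hc : IsStarNormal c) {z : ℂ} (hz : AccPt z (Filter.principal (spectrum ℂ c))) {ε : ℝ}
    (hε : 0 < ε) :
    ∃ V : H →L[ℂ] H, star V * V = 1 ∧ V * star V = 1 - (eigSpace c z).starProjection ∧
      ‖V * c * star V - c * (1 - (eigSpace c z).starProjection)‖ ≤ 2 * ε := by
  set M := discSubspace c z ε with hM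
  set Z := eigSpace c z with hZ
  set N := M ⊓ Zᗮ with hN
  have hZM : Z ≤ M := eigSpace_le_discSubspace hc z hε
  have hNinf := not_finiteDimensional_discSubspace_inf hc hz hε
  have hMinf : ¬ FiniteDimensional ℂ M := fun h =>
    hNinf (Submodule.finiteDimensional_of_le (S₂ := M) inf_le_left)
  have hNc : CompleteSpace N := by
    have h1 : IsClosed (M : Set H) := ContinuousLinearMap.isClosed_ker _
    exact (h1.inter Z.isClosed_orthogonal).completeSpace_coe
  obtain ⟨W⟩ := nonempty_linearIsometryEquiv_of_infinite hMinf hNinf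
  obtain ⟨w, hw1, hw2⟩ := exists_partialIsometry M N W
  set P := M.starProjection with hP
  set E := Z.starProjection with hE
  have hPs : IsStarProjection P := isStarProjection_starProjection
  have hPP : P * P = P := hPs.isIdempotentElem
  have hPstar : star P = P := hPs.isSelfAdjoint
  have hPE : P * E = E := by
    ext x
    exact Submodule.starProjection_eq_self_iff.mpr (hZM (Submodule.starProjection_apply_mem Z x))
  have hNs : N.starProjection = P - E := by
    ext x
    have h1 : x - P x ∈ Mᗮ := Submodule.sub_starProjection_mem_orthogonal x
    have h2 : x - E x ∈ Zᗮ := Submodule.sub_starProjection_mem_orthogonal x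
    have h3 : P x ∈ M := Submodule.starProjection_apply_mem M x
    have h4 : E x ∈ Z := Submodule.starProjection_apply_mem Z x
    refine (Submodule.eq_starProjection_of_mem_orthogonal (K := N) (v := (P - E) x)
      (Submodule.mem_inf.mpr ⟨?_, ?_⟩) ?_)
    · exact sub_mem h3 (hZM h4)
    · have : (P - E) x = (x - E x) - (x - P x) := by rw [sub_apply]; abel
      rw [this]
      exact sub_mem h2 (Submodule.orthogonal_le hZM h1)
    · have : x - (P - E) x = (x - P x) + E x := by rw [sub_apply]; abel
      rw [this]
      exact add_mem (Submodule.orthogonal_le inf_le_left h1)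
        (Submodule.orthogonal_le inf_le_right (Submodule.le_orthogonal_orthogonal Z h4))
  have hwP : w * P = w := mul_eq_self_of_star_mul_self_eq hPs hw1
  have hPw : P * w = w := by
    calc P * w = P * (w * (star w * w)) := by rw [hw1, hwP]
      _ = P * (w * star w) * w := by simp only [mul_assoc]
      _ = (w * star w) * w := by rw [hw2, hNs, mul_sub, hPP, hPE]
      _ = w := by rw [mul_assoc, hw1, hwP]
  have hPw' : P * star w = star w := by
    have := congrArg star hwP
    rwa [star_mul, hPstar] at this
  have hwP' : star w * P = star w := by
    have := congrArg star hPw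
    rwa [star_mul, hPstar] at this
  have hVs : star (w + (1 - P)) = star w + (1 - P) := by
    rw [star_add, star_sub, star_one, hPstar]
  have hVV : (w + (1 - P)) * star (w + (1 - P)) = 1 - E := by
    rw [hVs]
    calc _ = w * star w + (w - w * P) + (star w - P * star w) + (1 - P - P + P * P) := by
          noncomm_ring
      _ = _ := by rw [hwP, hPw', hPP, hw2, hNs]; abel
  refine ⟨w + (1 - P), ?_, hVV, ?_⟩
  · rw [hVs]
    calc _ = star w * w + (star w - star w * P) + (w - P * w) + (1 - P - P + P * P) := by
          noncomm_ring
      _ = 1 := by rw [hwP', hPw, hPP, hw1]; abel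
  set d := c - z • (1 : H →L[ℂ] H) with hd
  have hdP : d * P = P * d := by
    have := starProjection_mul_comm_of_mapsTo (M := M)
      (fun x hx => (apply_mem_discSubspace hc z ε hx).1)
      (fun x hx => (apply_mem_discSubspace hc z ε hx).2)
    rw [hd, sub_mul, mul_sub, hP, this]
    simp
  have hcd : c = d + z • (1 : H →L[ℂ] H) := by rw [hd, sub_add_cancel]
  have hdiff : (w + (1 - P)) * c * star (w + (1 - P)) - c * (1 - E) =
      w * (d * P) * star w - d * P * (P - E) := by
    have h1 : (w + (1 - P)) * c * star (w + (1 - P)) =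
        (w + (1 - P)) * d * star (w + (1 - P)) + z • (1 - E) := by
      rw [← hVV]
      conv_lhs => rw [hcd]
      rw [mul_add, add_mul, mul_smul_comm, smul_mul_assoc, mul_one]
    have h2 : c * (1 - E) = d * (1 - E) + z • (1 - E) := by
      conv_lhs => rw [hcd]
      rw [add_mul, smul_mul_assoc, one_mul]
    have h3 : P * d * P = d * P := by rw [← hdP, mul_assoc, hPP]
    have h4 : w * d * P = w * d := by
      rw [mul_assoc, hdP, ← mul_assoc, hwP]
    have h5 : P * d * star w = d * star w := by
      rw [← hdP, mul_assoc, hPw']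
    have h6 : d * P * E = d * E := by rw [mul_assoc, hPE]
    have h7 : d * P * P = d * P := by rw [mul_assoc, hPP]
    rw [h1, h2, hVs]
    calc _ = w * d * star w + (w * d - w * d * P) + (d * star w - P * d * star w)
          + (d - d * P - P * d + P * d * P) - d + d * E := by noncomm_ring
      _ = w * d * star w - d * P + d * E := by rw [h4, h5, h3, ← hdP]; abel
      _ = w * d * P * star w - d * P * P + d * P * E := by rw [h4, h6, h7]
      _ = _ := by noncomm_ring
  have hdPn : ‖d * P‖ ≤ ε := by
    refine opNorm_le_bound _ hε.le fun x => ?_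
    refine (norm_apply_le_of_mem_discSubspace hc z hε (Submodule.starProjection_apply_mem M x)).trans
      ?_
    gcongr
    exact Submodule.norm_starProjection_apply_le M x
  have hwn : ‖w‖ ≤ 1 := norm_le_one_of_star_mul_self_eq_starProjection hw1
  have hwn' : ‖star w‖ ≤ 1 := by rwa [norm_star]
  have hNn : ‖P - E‖ ≤ 1 := hNs ▸ N.starProjection_norm_le
  rw [hdiff]
  calc _ ≤ ‖w * (d * P) * star w‖ + ‖d * P * (P - E)‖ := norm_sub_le _ _
    _ ≤ ‖w‖ * ‖d * P‖ * ‖star w‖ + ‖d * P‖ * ‖P - E‖ :=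
      add_le_add ((norm_mul_le _ _).trans
        (mul_le_mul_of_nonneg_right (norm_mul_le _ _) (norm_nonneg _))) (norm_mul_le _ _)
    _ ≤ 1 * ε * 1 + ε * 1 := by gcongr
    _ = 2 * ε := by ring

theorem isometry_conj_mem_groupoidOrbit {a U : H →L[ℂ] H} (ha : IsStarNormal a)
    (hU : star U * U = 1) : U * a * star U ∈ groupoidOrbit a := by
  have hp := isStarProjection_rangeProjection a
  have hs := hp.isSelfAdjoint.star_eq
  have hvv : star (U * rangeProjection a) * (U * rangeProjection a) = rangeProjection a := by
    calc _ = rangeProjection a * (star U * U) * rangeProjection a := by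
          rw [star_mul, hs]; simp only [mul_assoc]
      _ = _ := by rw [hU, mul_one, hp.isIdempotentElem]
  refine ⟨U * rangeProjection a, ⟨?_, ha, hvv⟩, ?_⟩
  · rw [IsPartialIsometry, hvv]; exact hp
  · calc U * a * star U = U * (rangeProjection a * (a * rangeProjection a)) * star U := by
          rw [self_mul_rangeProjection ha, rangeProjection_mul_self]
      _ = _ := by rw [star_mul, hs]; simp only [mul_assoc]

theorem eigSpace_eq_bot_iff_of_mem_groupoidOrbit {a b : H →L[ℂ] H} (hb : b ∈ groupoidOrbit a)
    {z : ℂ} (hz : z ≠ 0) : eigSpace b z = ⊥ ↔ eigSpace a z = ⊥ := by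
  obtain ⟨v, hv, rfl⟩ := hb
  simp only [Submodule.eq_bot_iff]
  constructor
  · intro h x hx
    exact hv.eq_zero_of_apply_eq_zero hz hx (h _ (hv.mul_mem_eigSpace hz hx))
  · intro h y hy
    exact eq_zero_of_star_apply_eq_zero hz hy (h _ (hv.star_mul_mem_eigSpace hy))

theorem eigSpace_eq_bot_of_isClosed_groupoidOrbit [TopologicalSpace.SeparableSpace H]
    {a : H →L[ℂ] H} (ha : IsStarNormal a) (hcl : IsClosed (groupoidOrbit a)) {z : ℂ} (hz : z ≠ 0)
    (hacc : AccPt z (Filter.principal (spectrum ℂ a))) : eigSpace a z = ⊥ := by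
  set E := (eigSpace a z).starProjection with hE
  have hEE : E * E = E := (isStarProjection_starProjection).isIdempotentElem
  have hmem : a * (1 - E) ∈ groupoidOrbit a := by
    rw [← hcl.closure_eq, Metric.mem_closure_iff]
    intro ε hε
    obtain ⟨V, hV, -, hn⟩ := exists_isometry_norm_conj_sub_le ha hacc (ε := ε / 3) (by positivity)
    refine ⟨_, isometry_conj_mem_groupoidOrbit ha hV, ?_⟩
    rw [dist_comm, dist_eq_norm]
    linarith
  rw [← eigSpace_eq_bot_iff_of_mem_groupoidOrbit hmem hz, Submodule.eq_bot_iff]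
  intro y hy
  have hcomm : a * E = E * a := by
    refine starProjection_mul_comm_of_mapsTo (fun x hx => ?_) fun x hx => ?_
    · rw [mem_eigSpace.mp hx]; exact Submodule.smul_mem _ _ hx
    · rw [star_apply_of_mem_eigSpace ha hx]; exact Submodule.smul_mem _ _ hx
  have h0 : E * (a * (1 - E)) = 0 := by
    rw [← mul_assoc, ← hcomm, mul_assoc, mul_sub, hEE, mul_one, sub_self, mul_zero]
  have hy' := mem_eigSpace.mp hy
  have hEy : E y = 0 := by
    have h1 := congrArg E hy'
    rw [← mul_apply_eq_comp, h0, map_smul, zero_apply] at h1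
    exact (smul_eq_zero.mp h1.symm).resolve_left hz
  have hay : y ∈ eigSpace a z := by
    rw [mem_eigSpace, ← hy', mul_apply_eq_comp, sub_apply, hEy, sub_zero]
    rfl
  rw [← Submodule.starProjection_eq_self_iff.mpr hay]
  exact hEy

theorem exists_nonunitary_isometry [TopologicalSpace.SeparableSpace H]
    (hinf : ¬ FiniteDimensional ℂ H) :
    ∃ J : H →L[ℂ] H, star J * J = 1 ∧ ∃ y : H, y ≠ 0 ∧ star J y = 0 := by
  have : Nontrivial H := by
    by_contra h
    have := not_nontrivial_iff_subsingleton.mp h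
    exact hinf inferInstance
  obtain ⟨y, hy⟩ := exists_ne (0 : H)
  have hL : ¬ FiniteDimensional ℂ ↥(ℂ ∙ y)ᗮ := fun h => by
    have h1 := Submodule.finiteDimensional_sup (ℂ ∙ y) (ℂ ∙ y)ᗮ
    rw [Submodule.sup_orthogonal_of_hasOrthogonalProjection] at h1
    exact hinf (Submodule.topEquiv.finiteDimensional)
  have hT : ¬ FiniteDimensional ℂ ↥(⊤ : Submodule ℂ H) := fun h =>
    hinf (Submodule.topEquiv.finiteDimensional)
  have hc : CompleteSpace ↥(⊤ : Submodule ℂ H) :=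
    (isClosed_univ : IsClosed ((⊤ : Submodule ℂ H) : Set H)).completeSpace_coe
  obtain ⟨W⟩ := nonempty_linearIsometryEquiv_of_infinite hT hL
  obtain ⟨J, h1, h2⟩ := exists_partialIsometry ⊤ (ℂ ∙ y)ᗮ W
  rw [Submodule.starProjection_top'] at h1
  refine ⟨J, h1, y, hy, ?_⟩
  have h3 : (J * star J) y = 0 := by
    rw [h2]
    exact Submodule.starProjection_orthogonal_apply_eq_zero (Submodule.mem_span_singleton_self y)
  calc star J y = (star J * J) (star J y) := by rw [h1]; rfl
    _ = star J ((J * star J) y) := rfl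
    _ = 0 := by rw [h3, map_zero]

theorem not_accPt_of_isClosed_groupoidOrbit [TopologicalSpace.SeparableSpace H]
    (hinf : ¬ FiniteDimensional ℂ H) {a : H →L[ℂ] H} (ha : IsStarNormal a)
    (hcl : IsClosed (groupoidOrbit a)) {z : ℂ} (hz : z ≠ 0) :
    ¬ AccPt z (Filter.principal (spectrum ℂ a)) := by
  intro hacc
  have hbot := eigSpace_eq_bot_of_isClosed_groupoidOrbit ha hcl hz hacc
  obtain ⟨J, hJ, y, hy, hJy⟩ := exists_nonunitary_isometry hinf
  set q : H →L[ℂ] H := 1 - J * star J with hq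
  have hqs : star q = q := by rw [hq]; simp
  have hqJ : q * J = 0 := by rw [hq, sub_mul, mul_assoc, hJ]; simp
  have hJq : star J * q = 0 := by
    have := congrArg star hqJ
    rwa [star_mul, hqs, star_zero] at this
  set b : H →L[ℂ] H := J * a * star J + z • q with hb
  have hbJ : b * J = J * a := by
    rw [hb, add_mul, mul_assoc _ (star J) J, hJ, smul_mul_assoc, hqJ, smul_zero, add_zero, mul_one]
  have hJb : star J * b = a * star J := by
    rw [hb, mul_add, ← mul_assoc, ← mul_assoc, hJ, mul_smul_comm, hJq, smul_zero, add_zero, one_mul]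
  have hbq : b * q = z • q := by
    have hqq : q * q = q := by
      conv_lhs => enter [1]; rw [hq]
      rw [sub_mul, mul_assoc, hJq, mul_zero, sub_zero, one_mul]
    rw [hb, add_mul, mul_assoc, hJq, mul_zero, zero_add, smul_mul_assoc, hqq]
  have hbn : IsStarNormal b := by
    constructor
    have h1 : star a * a = a * star a := ha.star_comm_self
    have hbs : star b = J * star a * star J + star z • q := by
      rw [hb, star_add, star_smul, hqs, star_mul, star_mul, star_star]
      simp only [mul_assoc]
    have key : ∀ (s t : H →L[ℂ] H) (α β : ℂ),
        (J * s * star J + α • q) * (J * t * star J + β • q) =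
          J * (s * t) * star J + (α * β) • (q * q) := by
      intro s t α β
      calc _ = J * s * (star J * J) * t * star J + β • (J * s * (star J * q)) +
            α • ((q * J) * t * star J) + (α * β) • (q * q) := by
            simp only [add_mul, mul_add, smul_mul_assoc, mul_smul_comm, smul_add, smul_smul,
              mul_assoc, mul_comm β α]
            abel
        _ = _ := by
            rw [hJ, hJq, hqJ]
            simp only [mul_assoc, mul_zero, zero_mul, smul_zero, add_zero, mul_one]
    change star b * b = b * star b
    rw [hbs, hb, key, key, h1, mul_comm z]
  have hspec : spectrum ℂ a ⊆ spectrum ℂ b := by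
    intro w hw
    by_contra hwb
    obtain ⟨u, hu⟩ := notMem_spectrum_iff_isUnit_sub.mp hwb
    have h1 : (u : H →L[ℂ] H) * J = J * (a - w • 1) := by
      rw [hu, sub_mul, mul_sub, hbJ]; simp
    have h2 : star J * (u : H →L[ℂ] H) = (a - w • 1) * star J := by
      rw [hu, sub_mul, mul_sub, hJb]; simp
    refine notMem_spectrum_iff_isUnit_sub.mpr (isUnit_iff_exists.mpr
      ⟨star J * ((u⁻¹ : (H →L[ℂ] H)ˣ) : H →L[ℂ] H) * J, ?_, ?_⟩) hw
    · rw [← mul_assoc, ← mul_assoc, ← h2, mul_assoc (star J), Units.mul_inv, mul_one, hJ]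
    · rw [mul_assoc, ← h1, mul_assoc, ← mul_assoc _ (u : H →L[ℂ] H), Units.inv_mul, one_mul, hJ]
  have hbacc : AccPt z (Filter.principal (spectrum ℂ b)) :=
    hacc.mono (Filter.principal_mono.mpr hspec)
  have hE : (eigSpace b z).starProjection = q := by
    ext x
    refine Submodule.eq_starProjection_of_mem_orthogonal ?_ ?_
    · rw [mem_eigSpace, ← mul_apply_eq_comp, hbq, smul_apply]
    · have hxq : x - q x = J (star J x) := by rw [hq]; simp
      rw [hxq, Submodule.mem_orthogonal]
      intro t ht
      have hJt : star J t = 0 := by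
        have : star J t ∈ eigSpace a z := by
          rw [mem_eigSpace, ← mul_apply_eq_comp, ← hJb, mul_apply_eq_comp, mem_eigSpace.mp ht,
            map_smul]
        rw [hbot] at this
        exact (Submodule.mem_bot ℂ).mp this
      rw [← adjoint_inner_left, ← star_eq_adjoint, hJt, inner_zero_left]
  have hmem : b ∈ groupoidOrbit a := by
    rw [← hcl.closure_eq, Metric.mem_closure_iff]
    intro ε hε
    obtain ⟨V, hV, hV', hn⟩ :=
      exists_isometry_norm_conj_sub_le hbn hbacc (ε := ε / 3) (by positivity)
    have h1q : 1 - q = J * star J := by rw [hq, sub_sub_cancel]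
    rw [hE, h1q] at hV' hn
    have hU : star (star V * J) * (star V * J) = 1 := by
      calc _ = star J * (V * star V) * J := by rw [star_mul, star_star]; simp only [mul_assoc]
        _ = (star J * J) * (star J * J) := by rw [hV']; simp only [mul_assoc]
        _ = 1 := by rw [hJ, one_mul]
    refine ⟨_, isometry_conj_mem_groupoidOrbit ha hU, ?_⟩
    have hdiff : b - star V * J * a * star (star V * J) =
        star V * (V * b * star V - b * (J * star J)) * V := by
      calc _ = (star V * V) * b * (star V * V) - star V * (J * a) * star J * V := by
            rw [hV, star_mul, star_star]; simp only [mul_assoc, one_mul, mul_one]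
        _ = _ := by rw [← hbJ]; noncomm_ring
    have hVn : ‖V‖ ≤ 1 :=
      norm_le_one_of_star_mul_self_eq_starProjection (M := ⊤) (by rw [hV, Submodule.starProjection_top'])
    have hVn' : ‖star V‖ ≤ 1 := by rwa [norm_star]
    rw [dist_eq_norm, hdiff]
    calc _ ≤ ‖star V‖ * ‖V * b * star V - b * (J * star J)‖ * ‖V‖ :=
          (norm_mul_le _ _).trans (mul_le_mul_of_nonneg_right (norm_mul_le _ _) (norm_nonneg _))
      _ ≤ 1 * (2 * (ε / 3)) * 1 := by gcongr
      _ < ε := by linarith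
  have hbb := (eigSpace_eq_bot_iff_of_mem_groupoidOrbit hmem hz).mpr hbot
  refine hy ((Submodule.mem_bot ℂ).mp (hbb ▸ ?_))
  have hqy : q y = y := by rw [hq]; simp [hJy]
  rw [← hqy, mem_eigSpace, ← mul_apply_eq_comp, hbq, smul_apply]

end Operators

end

theorem mainTheorem9 {H : Type*} [NormedAddCommGroup H] [InnerProductSpace ℂ H]
    [CompleteSpace H] [TopologicalSpace.SeparableSpace H]
    (hinf : ¬ FiniteDimensional ℂ H)
    (a : H →L[ℂ] H) (ha : IsStarNormal a) :
    IsClosed (groupoidOrbit a) ↔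
      ∀ z : ℂ, AccPt z (Filter.principal (spectrum ℂ a)) → z = 0 := by
  refine ⟨fun hcl z hz => ?_, isClosed_groupoidOrbit ha⟩
  by_contra h0
  exact not_accPt_of_isClosed_groupoidOrbit hinf ha hcl h0 hz
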